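/- Let $\mathcal{C}$ be a commutative integral domain with $1$, $x=(x_1,\dots,x_n)$, and let $\prec$ be a local monomial order on $\mathbb{N}^n$: a total order, compatible with addition, with $\alpha\preceq 0$ for all $\alpha$. Let $J$ be an ideal of $\mathcal{C}[[x]]$ and $\mathcal{Q}$ a prime ideal of $\mathcal{C}$. For an ideal $\mathcal I$ and an element $h$ of $\mathcal C$ put $V(\mathcal I)=\{\mathcal P\in\mathrm{Spec}\,\mathcal C:\mathcal I\subset\mathcal P\}$ and $V(h)=V((h))$. *Over a field $K$.* For $0\neq f\in K[[x]]$ let $\mathrm{ND}(f)$ be the set of exponents of $f$, $\exp(f)=\max_\prec \mathrm{ND}(f)$, and $\mathrm{lc}(f)$ the coefficient at $\exp(f)$. For an ideal $I\subset K[[x]]$ let $\mathrm{Exp}(I)=\{\exp(f): 0\ne f\in I\}$. A finite set $G\subset I\smallsetminus\{0\}$ is a standard basis of $I$ if $\mathrm{Exp}(I)=\bigcup_{g\in G}(\exp(g)+\mathbb{N}^n)$. It is the reduced standard basis if moreover (minimality) every $F\subset\mathbb{N}^n$ with $\mathrm{Exp}(I)=\bigcup_{e\in F}(e+\mathbb{N}^n)$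 contains all $\exp(g)$, $g\in G$, and for each $g\in G$ one has $\mathrm{lc}(g)=1$ and $\mathrm{ND}(g)\smallsetminus\{\exp(g)\}\subset\mathbb{N}^n\smallsetminus\mathrm{Exp}(I)$. *Specialization.* For a prime $\mathcal{P}$ of $\mathcal C$ and $h\notin\mathcal P$, let $(\cdot)_\mathcal{P}:\mathcal{C}[h^{-1}][[x]]\to \mathrm{Frac}(\mathcal{C}/\mathcal{P})[[x]]$ be the coefficientwise map; $(J)_\mathcal{P}$ is the ideal of $\mathrm{Frac}(\mathcal{C}/\mathcal{P})[[x]]$ generated by the $(f)_\mathcal{P}$, $f\in J$, and $(\mathcal G)_\mathcal P=\{(g)_\mathcal P: g\in\mathcal G\}$. *Generic standard bases.* For $h\in\mathcal C\smallsetminus\mathcal Q$ and $f\in\mathcal{C}[h^{-1}][[x]]$ not having all its coefficients in $\mathcal{Q}[h^{-1}]$, let $\exp^{\mathrm{mod}\,\mathcal{Q}}(f)$ be the $\prec$-largest exponent whose coefficient is not in $\mathcal{Q}[h^{-1}]$, and $\mathrm{lc}^{\mathrm{mod}\,\mathcal{Q}}(f)$ that coefficient; let $\mathrm{Exp}^{\mathrm{mod}\,\mathcal{Q}}(J)$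 be the set of $\exp^{\mathrm{mod}\,\mathcal{Q}}(f)$ with $f\in J\smallsetminus\mathcal{Q}[[x]]$. A generic standard basis of $J$ on $V(\mathcal{Q})$ is a pair $(\mathcal{G},h)$ such that (a) $h\in\mathcal{C}\smallsetminus\mathcal{Q}$; (b) $\mathcal{G}$ is a finite subset of $\mathcal{C}[h^{-1}][[x]]\cdot J$, no $g\in\mathcal G$ has all its coefficients in $\mathcal Q[h^{-1}]$, and for each $g\in\mathcal{G}$ one can write $\mathrm{lc}^{\mathrm{mod}\,\mathcal{Q}}(g)=c/h^k$ with $c\in\mathcal C$ dividing $h$ and $k\in\mathbb N$; (c) $\mathrm{Exp}^{\mathrm{mod}\,\mathcal{Q}}(J)=\bigcup_{g\in\mathcal{G}}(\exp^{\mathrm{mod}\,\mathcal{Q}}(g)+\mathbb{N}^n)$. It is called a generic reduced standard basis of $J$ on $V(\mathcal{Q})$ if $(\mathcal{G})_\mathcal{Q}$ is the reduced standard basis of $(J)_\mathcal{Q}$. **Theorem.** 1. Suppose that for every $\alpha\in\mathbb N^n$ only finitely many $\beta\in\mathbb{N}^n$ satisfy $\beta\succ\alpha$, or that $\mathcal{C}/\mathcal{Q}$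 is Noetherian. Then there exists a generic reduced standard basis $(\mathcal{G},h)$ of $J$ on $V(\mathcal{Q})$. 2. (Without the assumption made in 1.) If $(\mathcal{G},h)$ is a generic reduced standard basis of $J$ on $V(\mathcal{Q})$, then for every $\mathcal{P}\in V(\mathcal{Q})\smallsetminus V(h)$, $(\mathcal{G})_\mathcal{P}$ is the reduced standard basis of $(J)_\mathcal{P}$. -/

import Mathlib

noncomputable section

namespace GenSB

/-- A local monomial order on the terms `x ^ α`, `α ∈ ℕ ^ n`: a total order (`le α β` reads
`x ^ α ≼ x ^ β`), compatible with products, for which every term is `≼ 1`. -/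
structure LocalOrder (n : ℕ) where
  le : (Fin n →₀ ℕ) → (Fin n →₀ ℕ) → Prop
  le_refl : ∀ α, le α α
  le_antisymm : ∀ α β, le α β → le β α → α = β
  le_trans : ∀ α β γ, le α β → le β γ → le α γ
  le_total : ∀ α β, le α β ∨ le β α
  add_le_add_right : ∀ α β γ, le α β → le (α + γ) (β + γ)
  le_zero : ∀ α, le α 0

/-- Above every term there are only finitely many terms. -/
def LocalOrder.FiniteAbove {n : ℕ} (ord : LocalOrder n) : Prop :=
  ∀ α : Fin n →₀ ℕ, {β | ord.le α β}.Finite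

/-! ### Leading exponents and standard bases over a field -/

section Field

variable {n : ℕ} {K : Type*} [Field K]

/-- The Newton diagram: the exponents that occur in `f`. -/
def newtonDiagram (f : MvPowerSeries (Fin n) K) : Set (Fin n →₀ ℕ) :=
  {α | MvPowerSeries.coeff α f ≠ 0}

/-- `α` is the leading exponent `exp f`, the `≼`-maximum of the Newton diagram of `f`
(no `α` qualifies when `f = 0`). -/
def IsLeadExp (ord : LocalOrder n) (f : MvPowerSeries (Fin n) K) (α : Fin n →₀ ℕ) : Prop :=
  α ∈ newtonDiagram f ∧ ∀ β ∈ newtonDiagram f, ord.le β α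

/-- The set of leading exponents of the members of a set of power series. -/
def leadExps (ord : LocalOrder n) (S : Set (MvPowerSeries (Fin n) K)) : Set (Fin n →₀ ℕ) :=
  {α | ∃ f ∈ S, IsLeadExp ord f α}

/-- `⋃ e ∈ F, (e + ℕ ^ n)`. -/
def generatedExps (F : Set (Fin n →₀ ℕ)) : Set (Fin n →₀ ℕ) :=
  {β | ∃ e ∈ F, ∃ γ, β = e + γ}

/-- `G` is a standard basis of `J`: a finite set of nonzero elements of `J` such that
`Exp J` is the union of the `exp g + ℕ ^ n`, `g ∈ G`. -/
structure IsStandardBasis (ord : LocalOrder n) (J : Ideal (MvPowerSeries (Fin n) K))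
    (G : Set (MvPowerSeries (Fin n) K)) : Prop where
  finite : G.Finite
  subset : ∀ g ∈ G, g ∈ J
  ne_zero : ∀ g ∈ G, g ≠ 0
  leadExps_eq : leadExps ord (J : Set (MvPowerSeries (Fin n) K)) =
    generatedExps (leadExps ord G)

/-- `G` is the reduced standard basis of `J`: it is a minimal standard basis whose leading
coefficients are `1`, and no non-leading exponent of a `g ∈ G` lies in `Exp J`. -/
structure IsReducedStandardBasis (ord : LocalOrder n) (J : Ideal (MvPowerSeries (Fin n) K))
    (G : Set (MvPowerSeries (Fin n) K)) : Prop where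
  isStandardBasis : IsStandardBasis ord J G
  minimal : ∀ F : Set (Fin n →₀ ℕ),
    leadExps ord (J : Set (MvPowerSeries (Fin n) K)) = generatedExps F → leadExps ord G ⊆ F
  leadCoeff_eq_one : ∀ g ∈ G, ∀ α, IsLeadExp ord g α → MvPowerSeries.coeff α g = 1
  reduced : ∀ g ∈ G, ∀ α, IsLeadExp ord g α →
    newtonDiagram g \ {α} ⊆ (leadExps ord (J : Set (MvPowerSeries (Fin n) K)))ᶜ

end Field

/-! ### Specialization -/

section Specialization

variable {n : ℕ} {C : Type*} [CommRing C]

/-- The specialization `c ↦ (c)_P` from `C` into `Frac (C ⧸ P)`. -/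
def specialize (P : Ideal C) : C →+* FractionRing (C ⧸ P) :=
  (algebraMap (C ⧸ P) (FractionRing (C ⧸ P))).comp (Ideal.Quotient.mk P)

theorem isUnit_specialize (P : Ideal C) [P.IsPrime] {h : C} (hP : h ∉ P) :
    IsUnit (specialize P h) := by
  refine isUnit_iff_ne_zero.mpr fun h0 => hP ?_
  have h1 : algebraMap (C ⧸ P) (FractionRing (C ⧸ P)) (Ideal.Quotient.mk P h) = 0 := h0
  rw [FaithfulSMul.algebraMap_eq_zero_iff] at h1
  exact Ideal.Quotient.eq_zero_iff_mem.mp h1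

/-- The specialization extended to `C[h⁻¹]`, for a prime `P` that does not contain `h`. -/
def specializeAway (P : Ideal C) [P.IsPrime] {h : C} (hP : h ∉ P) :
    Localization.Away h →+* FractionRing (C ⧸ P) :=
  IsLocalization.Away.lift h (isUnit_specialize P hP)

/-- `(J)_P`: the ideal of `Frac (C ⧸ P)[[x]]` generated by the `(f)_P` with `f ∈ J`. -/
def specializeIdeal (P : Ideal C) (J : Ideal (MvPowerSeries (Fin n) C)) :
    Ideal (MvPowerSeries (Fin n) (FractionRing (C ⧸ P))) :=
  Ideal.span (MvPowerSeries.map (specialize P) '' (J : Set (MvPowerSeries (Fin n) C)))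

/-- `(G)_P`: the set of the `(g)_P` with `g ∈ G ⊆ C[h⁻¹][[x]]`. -/
def specializeSet (P : Ideal C) [P.IsPrime] {h : C} (hP : h ∉ P)
    (G : Set (MvPowerSeries (Fin n) (Localization.Away h))) :
    Set (MvPowerSeries (Fin n) (FractionRing (C ⧸ P))) :=
  MvPowerSeries.map (specializeAway P hP) '' G

end Specialization

/-! ### Generic standard bases -/

section Generic

variable {n : ℕ} {C : Type*} [CommRing C]

/-- `α` is the leading exponent of `f` modulo the ideal `I` of coefficients: the `≼`-maximum
of the exponents whose coefficient is not in `I`. -/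
def IsLeadExpMod {R : Type*} [CommRing R] (ord : LocalOrder n) (I : Ideal R)
    (f : MvPowerSeries (Fin n) R) (α : Fin n →₀ ℕ) : Prop :=
  MvPowerSeries.coeff α f ∉ I ∧ ∀ β, MvPowerSeries.coeff β f ∉ I → ord.le β α

/-- The set of leading exponents modulo `I` of the members of `S`. -/
def leadExpsMod {R : Type*} [CommRing R] (ord : LocalOrder n) (I : Ideal R)
    (S : Set (MvPowerSeries (Fin n) R)) : Set (Fin n →₀ ℕ) :=
  {α | ∃ f ∈ S, IsLeadExpMod ord I f α}

/-- `Q[h⁻¹]`, the ideal of `C[h⁻¹]` of the fractions with numerator in `Q`. -/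
def awayIdeal (Q : Ideal C) (h : C) : Ideal (Localization.Away h) :=
  Q.map (algebraMap C (Localization.Away h))

/-- The ideal `C[h⁻¹][[x]] · J`. -/
def extendAway (J : Ideal (MvPowerSeries (Fin n) C)) (h : C) :
    Ideal (MvPowerSeries (Fin n) (Localization.Away h)) :=
  J.map (MvPowerSeries.map (algebraMap C (Localization.Away h)))

/-- `(G, h)` is a generic standard basis of `J` on `V(Q)`. The field `leadCoeff` says that every
`g ∈ G` has a leading exponent modulo `Q` (that is, `g ∉ Q[h⁻¹][[x]]`) and that the leading
coefficient of `g` modulo `Q` is of the form `c / h ^ k` with `c` dividing `h`. -/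
structure IsGenericStandardBasis (ord : LocalOrder n) (J : Ideal (MvPowerSeries (Fin n) C))
    (Q : Ideal C) (h : C) (G : Set (MvPowerSeries (Fin n) (Localization.Away h))) : Prop where
  notMem : h ∉ Q
  finite : G.Finite
  subset : ∀ g ∈ G, g ∈ extendAway J h
  leadCoeff : ∀ g ∈ G, ∃ α, IsLeadExpMod ord (awayIdeal Q h) g α ∧
    ∃ (c : C) (k : ℕ), c ∣ h ∧
      MvPowerSeries.coeff α g * algebraMap C (Localization.Away h) (h ^ k) =
        algebraMap C (Localization.Away h) c
  leadExps_eq : leadExpsMod ord Q (J : Set (MvPowerSeries (Fin n) C)) =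
    generatedExps (leadExpsMod ord (awayIdeal Q h) G)

/-- `(G, h)` is a generic reduced standard basis of `J` on `V(Q)`: a generic standard basis such
that `(G)_Q` is the reduced standard basis of `(J)_Q`. -/
def IsGenericReducedStandardBasis (ord : LocalOrder n) (J : Ideal (MvPowerSeries (Fin n) C))
    (Q : Ideal C) [Q.IsPrime] (h : C) (G : Set (MvPowerSeries (Fin n) (Localization.Away h))) :
    Prop :=
  ∃ hG : IsGenericStandardBasis ord J Q h G,
    IsReducedStandardBasis ord (specializeIdeal Q J) (specializeSet Q hG.notMem G)

end Generic

end GenSB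

end

noncomputable section

namespace GenSB

/-! ### Local monomial orders -/

namespace LocalOrder

variable {n : ℕ} (ord : LocalOrder n)

/-! Everything rests on division by series that are monic at their leading exponents, over an
arbitrary ring. Quotients and remainder are packed into one series `u`, and `recombine` sends `u` to
the dividend. This linear map is unitriangular for the order: the coefficient at `γ` of the image is
that of `u` plus a finite combination of coefficients of `u` at exponents strictly above `γ`. Since
the order has no infinite ascending chains, the map is bijective (`recombine_injective`,
`recombine_surjective`). Its inverse commutes with ring homomorphisms, and each coefficient of the
inverse depends on finitely many coefficients of the dividend.

For part 2, a generic reduced standard basis is monic modulo `Q`. Remainders of members of `J`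
already vanish modulo `Q`, hence also modulo `P ⊇ Q`. The finite dependence extends the vanishing to
the whole ideal `(J)_P`, so its leading exponents are still generated by those of the basis
(`IsReducedStandardBasis.map_of_injective`).

For part 1, the difficulty is that a member of `(J)_Q` may involve infinitely many denominators.
Only finitely many coefficients can be approximated from `J`; finiteness above each exponent, or
Artin–Rees in the Noetherian case, shows that this suffices to realize every leading exponent inside
`J` (`leadExps_specializeIdeal`). Inverting the finitely many leading coefficients at minimal
exponents and reducing by division gives the basis (`exists_isReducedStandardBasis`). -/

theorem le_of_ge {α β : Fin n →₀ ℕ} (h : β ≤ α) : ord.le α β := by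
  obtain ⟨γ, rfl⟩ := exists_add_of_le h
  simpa [add_comm] using ord.add_le_add_right γ 0 β (ord.le_zero γ)

theorem le_of_add_le_add_right {α β γ : Fin n →₀ ℕ} (h : ord.le (α + γ) (β + γ)) :
    ord.le α β := by
  rcases ord.le_total α β with h1 | h1
  · exact h1
  · have h2 := ord.le_antisymm _ _ h (ord.add_le_add_right _ _ γ h1)
    rw [add_right_cancel h2]
    exact ord.le_refl _

/-- A local order is well-founded downwards from `1`, by Dickson's lemma. -/
theorem wellFounded : WellFounded fun β γ => ¬ ord.le β γ := by
  have hw : WellQuasiOrdered fun a b => ord.le b a := by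
    intro f
    obtain ⟨a, b, hab, h⟩ := wellQuasiOrdered_le f
    exact ⟨a, b, hab, ord.le_of_ge h⟩
  have : IsPreorder (Fin n →₀ ℕ) fun a b => ord.le b a :=
    { refl := ord.le_refl
      trans := fun a b c h1 h2 => ord.le_trans c b a h2 h1 }
  refine Subrelation.wf ?_ hw.wellFounded
  intro a b h
  exact ⟨(ord.le_total a b).resolve_left h, h⟩

theorem exists_max {S : Set (Fin n →₀ ℕ)} (hS : S.Nonempty) :
    ∃ α ∈ S, ∀ β ∈ S, ord.le β α := by
  obtain ⟨α, hα, h⟩ := ord.wellFounded.has_min S hS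
  exact ⟨α, hα, fun β hβ => not_not.mp (h β hβ)⟩

end LocalOrder

/-! ### Division with prescribed supports of the quotients -/

section Division

open MvPowerSeries Finset.HasAntidiagonal

variable {n : ℕ} {ι : Type*}

/-- `sel` chooses, for each exponent in `⋃ i, (α i + ℕ ^ n)`, an index `i` responsible for it. -/
structure IsSelector (α : ι → Fin n →₀ ℕ) (sel : (Fin n →₀ ℕ) → Option ι) : Prop where
  le_of_eq_some : ∀ β i, sel β = some i → α i ≤ β
  not_le_of_eq_none : ∀ β, sel β = none → ∀ i, ¬ α i ≤ β

theorem exists_isSelector (α : ι → Fin n →₀ ℕ) : ∃ sel, IsSelector α sel := by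
  classical
  refine ⟨fun β => if h : ∃ i, α i ≤ β then some h.choose else none, ?_, ?_⟩
  · intro β i h
    split_ifs at h with h1
    rw [← Option.some.inj h]
    exact h1.choose_spec
  · intro β h i hi
    rw [dif_pos ⟨i, hi⟩] at h
    cases h

variable {R : Type*} [CommRing R]

/-- `f` has leading exponent `α` and leading coefficient `1`. -/
structure IsMonicAt (ord : LocalOrder n) (f : MvPowerSeries (Fin n) R) (α : Fin n →₀ ℕ) :
    Prop where
  coeff_eq_one : coeff α f = 1
  le : ∀ β, coeff β f ≠ 0 → ord.le β α

theorem IsMonicAt.map {S : Type*} [CommRing S] {ord : LocalOrder n}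
    {f : MvPowerSeries (Fin n) R} {α : Fin n →₀ ℕ} (h : IsMonicAt ord f α) (φ : R →+* S) :
    IsMonicAt ord (MvPowerSeries.map φ f) α where
  coeff_eq_one := by simp [h.coeff_eq_one]
  le β hβ := h.le β fun h0 => hβ (by simp [h0])

variable (sel : (Fin n →₀ ℕ) → Option ι) (α : ι → Fin n →₀ ℕ)

open Classical in
/-- The part of `u` with exponents selected by `i`, divided by `x ^ α i`. -/
def selectedPart (i : ι) : MvPowerSeries (Fin n) R →ₗ[R] MvPowerSeries (Fin n) R where
  toFun u := fun δ => if sel (δ + α i) = some i then coeff (δ + α i) u else 0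
  map_add' u v := by
    funext δ
    change (if sel (δ + α i) = some i then coeff (δ + α i) (u + v) else 0) =
      (if sel (δ + α i) = some i then coeff (δ + α i) u else 0) + if sel (δ + α i) = some i then coeff (δ + α i) v else 0
    split_ifs <;> simp
  map_smul' c u := by
    funext δ
    change (if sel (δ + α i) = some i then coeff (δ + α i) (c • u) else 0) =
      c * if sel (δ + α i) = some i then coeff (δ + α i) u else 0
    split_ifs <;> simp

open Classical in
theorem coeff_selectedPart (i : ι) (u : MvPowerSeries (Fin n) R) (δ : Fin n →₀ ℕ) :
    coeff δ (selectedPart sel α i u) =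
      if sel (δ + α i) = some i then coeff (δ + α i) u else 0 := rfl

open Classical in
/-- The part of `u` with exponents not selected. -/
def unselectedPart : MvPowerSeries (Fin n) R →ₗ[R] MvPowerSeries (Fin n) R where
  toFun u := fun β => if sel β = none then coeff β u else 0
  map_add' u v := by
    funext δ
    change (if sel δ = none then coeff (δ) (u + v) else 0) =
      (if sel δ = none then coeff (δ) u else 0) + if sel δ = none then coeff (δ) v else 0
    split_ifs <;> simp
  map_smul' c u := by
    funext δ
    change (if sel δ = none then coeff (δ) (c • u) else 0) =
      c * if sel δ = none then coeff (δ) u else 0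
    split_ifs <;> simp

open Classical in
theorem coeff_unselectedPart (u : MvPowerSeries (Fin n) R) (β : Fin n →₀ ℕ) :
    coeff β (unselectedPart sel u) = if sel β = none then coeff β u else 0 := rfl

theorem coeff_unselectedPart_eq_zero (x : MvPowerSeries (Fin n) R) {β : Fin n →₀ ℕ}
    (hβ : sel β ≠ none) : coeff β (unselectedPart sel x) = 0 := by
  classical
  rw [coeff_unselectedPart, if_neg hβ]

variable [Fintype ι]

/-- The series whose quotients and remainder in the division by the `f i` are encoded by `u`. -/
def recombine (f : ι → MvPowerSeries (Fin n) R) :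
    MvPowerSeries (Fin n) R →ₗ[R] MvPowerSeries (Fin n) R :=
  ∑ i, (LinearMap.mulRight R (f i)).comp (selectedPart sel α i) + unselectedPart sel

theorem recombine_apply (f : ι → MvPowerSeries (Fin n) R) (u : MvPowerSeries (Fin n) R) :
    recombine sel α f u = ∑ i, selectedPart sel α i u * f i + unselectedPart sel u := by
  simp [recombine]

theorem map_recombine {S : Type*} [CommRing S] (φ : R →+* S) (f : ι → MvPowerSeries (Fin n) R)
    (u : MvPowerSeries (Fin n) R) :
    MvPowerSeries.map φ (recombine sel α f u) =
      recombine sel α (fun i => MvPowerSeries.map φ (f i)) (MvPowerSeries.map φ u) := by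
  classical
  simp only [recombine_apply, map_add, map_sum, map_mul]
  congr 1
  · refine Finset.sum_congr rfl fun i _ => ?_
    congr 1
    ext δ
    simp only [coeff_map, coeff_selectedPart]
    split_ifs <;> simp
  · ext δ
    simp only [coeff_map, coeff_unselectedPart]
    split_ifs <;> simp

variable {sel α}

-- If every `f i` were the monomial `x ^ α i`, recombining would return `u`, since each exponent is
-- either selected by exactly one index or unselected. The double sum is the contribution of the
-- tails `f i - x ^ α i`.
open Classical in
theorem coeff_recombine (hsel : IsSelector α sel) (f : ι → MvPowerSeries (Fin n) R)
    (u : MvPowerSeries (Fin n) R) (γ : Fin n →₀ ℕ) :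
    coeff γ (recombine sel α f u) = coeff γ u + ∑ i, ∑ p ∈ antidiagonal γ,
      coeff p.1 (selectedPart sel α i u) * (coeff p.2 (f i) - if p.2 = α i then 1 else 0) := by
  have h1 : ∀ i, ∑ p ∈ antidiagonal γ,
      coeff p.1 (selectedPart sel α i u) * (if p.2 = α i then 1 else 0) =
        if sel γ = some i then coeff γ u else 0 := by
    intro i
    by_cases hi : α i ≤ γ
    · obtain ⟨δ, hδ⟩ := exists_add_of_le hi
      rw [Finset.sum_eq_single (δ, α i)]
      · rw [coeff_selectedPart, add_comm δ, ← hδ]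
        simp
      · rintro ⟨a, b⟩ hp hne
        rw [mem_antidiagonal] at hp
        rw [if_neg, mul_zero]
        intro hb
        simp only at hb hp
        subst hb
        apply hne
        rw [hδ, add_comm] at hp
        rw [add_left_cancel hp]
      · intro hp
        exact absurd (mem_antidiagonal.mpr (by rw [hδ, add_comm])) hp
    · rw [if_neg fun h => hi (hsel.le_of_eq_some _ _ h)]
      refine Finset.sum_eq_zero fun p hp => ?_
      rw [if_neg, mul_zero]
      intro hb
      apply hi
      rw [← hb, ← mem_antidiagonal.mp hp]
      exact le_add_self
  have h2 : ∑ i, (if sel γ = some i then coeff γ u else 0) +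
      coeff γ (unselectedPart sel u) = coeff γ u := by
    rw [coeff_unselectedPart]
    rcases h : sel γ with _ | j
    · simp
    · simp
  simp only [mul_sub, Finset.sum_sub_distrib, h1]
  rw [recombine_apply, map_add, map_sum]
  simp only [coeff_mul]
  linear_combination h2

/-- The tail `f - x ^ α` lives strictly below `α`. Hence only coefficients of `u` at exponents
strictly above `γ` perturb the coefficient at `γ`: this is the triangularity of `recombine`. -/
theorem IsMonicAt.tail_eq_zero [DecidableEq (Fin n →₀ ℕ)] {ord : LocalOrder n}
    {f : MvPowerSeries (Fin n) R} {α : Fin n →₀ ℕ}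
    (hf : IsMonicAt ord f α) {δ ε : Fin n →₀ ℕ} (h : ord.le (δ + α) (δ + ε)) :
    coeff ε f - (if ε = α then 1 else 0) = 0 := by
  split_ifs with h1
  · rw [h1, hf.coeff_eq_one, sub_self]
  · rw [sub_zero]
    by_contra h2
    refine h1 (ord.le_antisymm _ _ (hf.le _ h2) ?_)
    rw [add_comm δ, add_comm δ] at h
    exact ord.le_of_add_le_add_right h

variable {ord : LocalOrder n} {f : ι → MvPowerSeries (Fin n) R}

theorem coeff_recombine_of_forall (hsel : IsSelector α sel) (hf : ∀ i, IsMonicAt ord (f i) (α i))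
    {u : MvPowerSeries (Fin n) R} {γ : Fin n →₀ ℕ} (h : ∀ β, ¬ ord.le β γ → coeff β u = 0) :
    coeff γ (recombine sel α f u) = coeff γ u := by
  classical
  rw [coeff_recombine hsel, add_eq_left]
  refine Finset.sum_eq_zero fun i _ => Finset.sum_eq_zero fun p hp => ?_
  rw [mem_antidiagonal] at hp
  by_cases hle : ord.le (p.1 + α i) γ
  · rw [(hf i).tail_eq_zero (hp.symm ▸ hle), mul_zero]
  · rw [coeff_selectedPart, h _ hle, ite_self, zero_mul]

/-- Each coefficient of `u` depends on finitely many coefficients of `recombine sel α f u`. -/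
theorem exists_finset_coeff_eq_zero (hsel : IsSelector α sel)
    (hf : ∀ i, IsMonicAt ord (f i) (α i)) (γ : Fin n →₀ ℕ) :
    ∃ S : Finset (Fin n →₀ ℕ), ∀ u : MvPowerSeries (Fin n) R,
      (∀ β ∈ S, coeff β (recombine sel α f u) = 0) → coeff γ u = 0 := by
  classical
  induction γ using ord.wellFounded.induction with
  | _ γ ih =>
    choose S hS using ih
    -- By triangularity the equation at `γ` involves only finitely many coefficients of `u`, all at
    -- exponents strictly above `γ`; their finite sets are collected.
    refine ⟨insert γ (Finset.univ.biUnion fun i => (antidiagonal γ).biUnion fun p =>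
      if h : ¬ ord.le (p.1 + α i) γ then S _ h else ∅), fun u hu => ?_⟩
    have h0 := hu γ (Finset.mem_insert_self _ _)
    rw [coeff_recombine hsel, Finset.sum_eq_zero, add_zero] at h0
    · exact h0
    refine fun i _ => Finset.sum_eq_zero fun p hp => ?_
    by_cases hle : ord.le (p.1 + α i) γ
    · rw [(hf i).tail_eq_zero ((mem_antidiagonal.mp hp).symm ▸ hle), mul_zero]
    · rw [coeff_selectedPart, hS _ hle u, ite_self, zero_mul]
      intro β hβ
      refine hu β (Finset.mem_insert_of_mem ?_)
      simp only [Finset.mem_biUnion]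
      exact ⟨i, Finset.mem_univ _, p, hp, by rwa [dif_pos hle]⟩

theorem recombine_injective (hsel : IsSelector α sel) (hf : ∀ i, IsMonicAt ord (f i) (α i)) :
    Function.Injective (recombine sel α f) := by
  rw [injective_iff_map_eq_zero]
  intro u hu
  ext γ
  obtain ⟨S, hS⟩ := exists_finset_coeff_eq_zero hsel hf γ
  exact hS u fun β _ => by simp [hu]

theorem recombine_surjective (hsel : IsSelector α sel) (hf : ∀ i, IsMonicAt ord (f i) (α i)) :
    Function.Surjective (recombine sel α f) := by
  classical
  intro g
  -- The triangular system is solved for the coefficients of `u` by recursion from the top exponent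
  -- downwards.
  let F : ∀ γ, (∀ β, ¬ ord.le β γ → R) → R := fun γ v =>
    coeff γ g - ∑ i, ∑ p ∈ antidiagonal γ,
      (if h : ¬ ord.le (p.1 + α i) γ then (if sel (p.1 + α i) = some i then v _ h else 0) else 0) *
        (coeff p.2 (f i) - if p.2 = α i then 1 else 0)
  let u : MvPowerSeries (Fin n) R := ord.wellFounded.fix F
  have hu : ∀ γ, coeff γ u = F γ fun β _ => coeff β u := fun γ =>
    ord.wellFounded.fix_eq F γ
  refine ⟨u, ?_⟩
  ext γ
  rw [coeff_recombine hsel, hu γ, sub_add_eq_add_sub, sub_eq_iff_eq_add]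
  congr 1
  refine Finset.sum_congr rfl fun i _ => Finset.sum_congr rfl fun p hp => ?_
  by_cases hle : ord.le (p.1 + α i) γ
  · rw [(hf i).tail_eq_zero ((mem_antidiagonal.mp hp).symm ▸ hle), mul_zero, mul_zero]
  · rw [dif_pos hle, coeff_selectedPart]

end Division

end GenSB

namespace GenSB

/-! ### Division under change of rings -/

section Division

open MvPowerSeries

variable {n : ℕ} {ι : Type*} [Fintype ι] {R : Type*} [CommRing R]
  {sel : (Fin n →₀ ℕ) → Option ι} {α : ι → Fin n →₀ ℕ} {ord : LocalOrder n}
  {f : ι → MvPowerSeries (Fin n) R}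

/-- Division by the `f i`, as the inverse of `recombine`. -/
def recombineEquiv (hsel : IsSelector α sel) (hf : ∀ i, IsMonicAt ord (f i) (α i)) :
    MvPowerSeries (Fin n) R ≃ₗ[R] MvPowerSeries (Fin n) R :=
  LinearEquiv.ofBijective (recombine sel α f)
    ⟨recombine_injective hsel hf, recombine_surjective hsel hf⟩

theorem recombine_symm_apply (hsel : IsSelector α sel) (hf : ∀ i, IsMonicAt ord (f i) (α i))
    (x : MvPowerSeries (Fin n) R) :
    recombine sel α f ((recombineEquiv hsel hf).symm x) = x :=
  (recombineEquiv hsel hf).apply_symm_apply x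

/-- Both sides solve the same division problem over `S`, whose solution is unique. -/
theorem map_recombineEquiv_symm {S : Type*} [CommRing S] (φ : R →+* S) (hsel : IsSelector α sel)
    (hf : ∀ i, IsMonicAt ord (f i) (α i)) (x : MvPowerSeries (Fin n) R) :
    MvPowerSeries.map φ ((recombineEquiv hsel hf).symm x) =
      (recombineEquiv hsel fun i => (hf i).map φ).symm (MvPowerSeries.map φ x) := by
  rw [LinearEquiv.eq_symm_apply]
  change recombine sel α _ _ = _
  rw [← map_recombine, recombine_symm_apply]

theorem coeff_mul_sub_sum_eq_zero
    (a x : MvPowerSeries (Fin n) R) {S T : Finset (Fin n →₀ ℕ)}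
    (hT : ∀ β ∈ S, ∀ δ ≤ β, δ ∈ T) {β : Fin n →₀ ℕ} (hβ : β ∈ S) :
    coeff β (a * x - ∑ δ ∈ T, monomial δ (coeff δ a) * x) = 0 := by
  classical
  rw [← Finset.sum_mul, ← sub_mul, coeff_mul]
  refine Finset.sum_eq_zero fun p hp => ?_
  have hp1 : p.1 ∈ T :=
    hT β hβ _ (by rw [← Finset.HasAntidiagonal.mem_antidiagonal.mp hp]; exact le_self_add)
  rw [map_sub, map_sum]
  simp only [coeff_monomial]
  rw [Finset.sum_ite_eq, if_pos hp1, sub_self, zero_mul]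

/-- If the remainders of all `x ^ δ * s` vanish, then so do those of all multiples of `s`, over
every ring to which the divisors are mapped. -/
theorem coeff_recombineEquiv_symm_mul_map_eq_zero {S : Type*} [CommRing S] (ψ : R →+* S)
    (hsel : IsSelector α sel) (hf : ∀ i, IsMonicAt ord (f i) (α i)) (s : MvPowerSeries (Fin n) R)
    {γ : Fin n →₀ ℕ}
    (hs : ∀ δ, coeff γ ((recombineEquiv hsel hf).symm (monomial δ 1 * s)) = 0)
    (a : MvPowerSeries (Fin n) S) :
    coeff γ ((recombineEquiv hsel fun i => (hf i).map ψ).symm (a * MvPowerSeries.map ψ s)) = 0 := by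
  classical
  set e := recombineEquiv hsel fun i => (hf i).map ψ with he
  obtain ⟨F, hF⟩ := exists_finset_coeff_eq_zero hsel (fun i => (hf i).map ψ) γ
  -- The coefficient at `γ` sees the product only at `F`, hence sees `a` only at exponents below
  -- some member of `F`. So `a` may be replaced by a finite sum of monomials, to which linearity
  -- applies.
  let T : Finset (Fin n →₀ ℕ) := F.biUnion Finset.Iic
  have h1 : coeff γ (e.symm (a * MvPowerSeries.map ψ s -
      ∑ δ ∈ T, monomial δ (coeff δ a) * MvPowerSeries.map ψ s)) = 0 := by
    refine hF _ fun β hβ => ?_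
    rw [recombine_symm_apply]
    exact coeff_mul_sub_sum_eq_zero a _
      (fun β hβ δ hδ => Finset.mem_biUnion.mpr ⟨β, hβ, Finset.mem_Iic.mpr hδ⟩) hβ
  have h2 : ∀ δ, coeff γ (e.symm (monomial δ (coeff δ a) * MvPowerSeries.map ψ s)) = 0 := by
    intro δ
    have h3 : monomial δ (coeff δ a) * MvPowerSeries.map ψ s =
        coeff δ a • MvPowerSeries.map ψ (monomial δ 1 * s) := by
      rw [map_mul, map_monomial, map_one, ← smul_mul_assoc, ← map_smul, smul_eq_mul, mul_one]
    rw [h3, map_smul, he, ← map_recombineEquiv_symm ψ hsel hf, coeff_smul, coeff_map, hs, map_zero, mul_zero]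
  rw [map_sub, map_sub, map_sum, map_sum, Finset.sum_eq_zero fun δ _ => h2 δ, sub_zero] at h1
  exact h1

end Division

/-! ### Leading exponents over a field -/

section Field

open MvPowerSeries

variable {n : ℕ} (ord : LocalOrder n) {K : Type*} [Field K]

theorem LocalOrder.exists_isLeadExp {f : MvPowerSeries (Fin n) K} (hf : f ≠ 0) :
    ∃ α, IsLeadExp ord f α := by
  obtain ⟨α, hα⟩ := (MvPowerSeries.ne_zero_iff_exists_coeff_ne_zero f).mp hf
  exact ord.exists_max (S := newtonDiagram f) ⟨α, hα⟩

variable {ord}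

theorem IsLeadExp.eq {f : MvPowerSeries (Fin n) K} {α β : Fin n →₀ ℕ} (hα : IsLeadExp ord f α)
    (hβ : IsLeadExp ord f β) : α = β :=
  ord.le_antisymm _ _ (hβ.2 _ hα.1) (hα.2 _ hβ.1)

theorem IsLeadExp.ne_zero {f : MvPowerSeries (Fin n) K} {α : Fin n →₀ ℕ}
    (hα : IsLeadExp ord f α) : f ≠ 0 := by
  rintro rfl
  exact hα.1 (map_zero _)

theorem IsMonicAt.isLeadExp {f : MvPowerSeries (Fin n) K} {α : Fin n →₀ ℕ}
    (h : IsMonicAt ord f α) : IsLeadExp ord f α :=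
  ⟨by simp [newtonDiagram, h.coeff_eq_one], fun β hβ => h.le β hβ⟩

theorem IsLeadExp.mul_monomial {f : MvPowerSeries (Fin n) K} {α : Fin n →₀ ℕ}
    (hα : IsLeadExp ord f α) (γ : Fin n →₀ ℕ) : IsLeadExp ord (f * monomial γ 1) (α + γ) := by
  classical
  refine ⟨?_, fun β hβ => ?_⟩
  · simpa [newtonDiagram, coeff_add_mul_monomial] using hα.1
  · simp only [newtonDiagram, Set.mem_ofPred_eq, coeff_mul_monomial] at hβ
    split_ifs at hβ with h
    · obtain ⟨δ, rfl⟩ := exists_add_of_le h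
      rw [add_tsub_cancel_left, mul_one] at hβ
      rw [add_comm γ]
      exact ord.add_le_add_right _ _ _ (hα.2 _ hβ)
    · exact absurd rfl hβ

theorem generatedExps_leadExps_subset {I : Ideal (MvPowerSeries (Fin n) K)}
    {G : Set (MvPowerSeries (Fin n) K)} (hG : ∀ g ∈ G, g ∈ I) :
    generatedExps (leadExps ord G) ⊆ leadExps ord (I : Set (MvPowerSeries (Fin n) K)) := by
  rintro _ ⟨α, ⟨g, hg, hα⟩, γ, rfl⟩
  exact ⟨_, I.mul_mem_right _ (hG g hg), hα.mul_monomial γ⟩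

/-- A member of an ideal none of whose exponents lies in the set of leading exponents is zero. -/
theorem eq_zero_of_mem_of_forall {I : Ideal (MvPowerSeries (Fin n) K)}
    {f : MvPowerSeries (Fin n) K} (hf : f ∈ I)
    (h : ∀ β ∈ leadExps ord (I : Set (MvPowerSeries (Fin n) K)), coeff β f = 0) : f = 0 := by
  by_contra h0
  obtain ⟨α, hα⟩ := ord.exists_isLeadExp h0
  exact hα.1 (h α ⟨f, hf, hα⟩)

end Field

/-! ### Reduced standard bases under specialization -/

section BaseChange

open MvPowerSeries

variable {n : ℕ} {ord : LocalOrder n} {R K L : Type*} [CommRing R] [Field K] [Field L]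

/-- Injectivity of `φ` makes the basis monic over `R` itself, so division by it takes place over `R`
and then maps to `L`. Vanishing of remainders passes from `K` to `R`, again by injectivity, and from
`R` to `L` by functoriality of division. -/
theorem IsReducedStandardBasis.map_of_injective {φ : R →+* K} (hφ : Function.Injective φ)
    (ψ : R →+* L) {I : Ideal (MvPowerSeries (Fin n) R)} {G : Set (MvPowerSeries (Fin n) R)}
    (hG : G.Finite) (hGI : ∀ g ∈ G, g ∈ I)
    (hK : IsReducedStandardBasis ord (I.map (MvPowerSeries.map φ)) (MvPowerSeries.map φ '' G)) :
    IsReducedStandardBasis ord (I.map (MvPowerSeries.map ψ)) (MvPowerSeries.map ψ '' G) := by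
  classical
  have h1 : ∀ g : G, ∃ α, IsLeadExp ord (MvPowerSeries.map φ g.1) α := fun g =>
    ord.exists_isLeadExp (hK.isStandardBasis.ne_zero _ ⟨g.1, g.2, rfl⟩)
  choose α hα using h1
  have hmon : ∀ g : G, IsMonicAt ord g.1 (α g) := by
    refine fun g => ⟨hφ ?_, fun β hβ => (hα g).2 β ?_⟩
    · rw [map_one, ← coeff_map]
      exact hK.leadCoeff_eq_one _ ⟨g.1, g.2, rfl⟩ _ (hα g)
    · simpa [newtonDiagram, map_eq_zero_iff φ hφ] using hβ
  have hleadK : leadExps ord (MvPowerSeries.map φ '' G) = Set.range α := by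
    ext β
    constructor
    · rintro ⟨_, ⟨g, hg, rfl⟩, h⟩
      exact ⟨⟨g, hg⟩, (hα ⟨g, hg⟩).eq h⟩
    · rintro ⟨g, rfl⟩
      exact ⟨_, ⟨g.1, g.2, rfl⟩, hα g⟩
  have hαL : ∀ g : G, IsLeadExp ord (MvPowerSeries.map ψ g.1) (α g) := fun g =>
    ((hmon g).map ψ).isLeadExp
  have hleadL : leadExps ord (MvPowerSeries.map ψ '' G) = Set.range α := by
    ext β
    constructor
    · rintro ⟨_, ⟨g, hg, rfl⟩, h⟩
      exact ⟨⟨g, hg⟩, (hαL ⟨g, hg⟩).eq h⟩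
    · rintro ⟨g, rfl⟩
      exact ⟨_, ⟨g.1, g.2, rfl⟩, hαL g⟩
  have hGL : ∀ g ∈ MvPowerSeries.map ψ '' G, g ∈ I.map (MvPowerSeries.map ψ) := by
    rintro _ ⟨g, hg, rfl⟩
    exact Ideal.mem_map_of_mem _ (hGI g hg)
  obtain ⟨sel, hsel⟩ := exists_isSelector α
  have : Fintype G := hG.fintype
  have hnone : ∀ β, sel β = none →
      β ∉ leadExps ord (I.map (MvPowerSeries.map φ) : Set (MvPowerSeries (Fin n) K)) := by
    intro β hβ h
    rw [hK.isStandardBasis.leadExps_eq, hleadK] at h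
    obtain ⟨_, ⟨g, rfl⟩, γ, rfl⟩ := h
    exact hsel.not_le_of_eq_none _ hβ g le_self_add
  have hremR : ∀ s ∈ I, ∀ γ, sel γ = none →
      coeff γ ((recombineEquiv hsel hmon).symm s) = 0 := by
    intro s hs γ hγ
    set u := (recombineEquiv hsel hmon).symm s with hu
    -- The remainder is a member of `I` whose image over `K` has no exponent among the leading
    -- exponents, so it is zero.
    have h2 : unselectedPart sel u = s - ∑ g : G, selectedPart sel α g u * g.1 := by
      rw [eq_sub_iff_add_eq', ← recombine_apply, hu, recombine_symm_apply]
    have h3 : unselectedPart sel u ∈ I := by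
      rw [h2]
      exact I.sub_mem hs (I.sum_mem fun g _ => I.mul_mem_left _ (hGI _ g.2))
    have h4 : MvPowerSeries.map φ (unselectedPart sel u) = 0 := by
      refine eq_zero_of_mem_of_forall (ord := ord) (Ideal.mem_map_of_mem _ h3) fun β hβ => ?_
      rw [coeff_map, coeff_unselectedPart_eq_zero sel _ fun h => hnone β h hβ, map_zero]
    have h5 : coeff γ (MvPowerSeries.map φ (unselectedPart sel u)) = 0 := by rw [h4, map_zero]
    rwa [coeff_map, map_eq_zero_iff φ hφ, coeff_unselectedPart, if_pos hγ] at h5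
  have hremL : ∀ x ∈ I.map (MvPowerSeries.map ψ), ∀ γ, sel γ = none →
      coeff γ ((recombineEquiv hsel fun g => (hmon g).map ψ).symm x) = 0 := by
    intro x hx γ hγ
    -- The claim is stated for all multiples of `x`, so that the span induction survives
    -- multiplication by arbitrary series.
    have h2 : ∀ a, coeff γ ((recombineEquiv hsel fun g => (hmon g).map ψ).symm (a * x)) = 0 := by
      refine Submodule.span_induction ?_ ?_ ?_ ?_ hx
      · rintro _ ⟨s, hs, rfl⟩ a
        exact coeff_recombineEquiv_symm_mul_map_eq_zero ψ hsel hmon s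
          (fun δ => hremR _ (I.mul_mem_left _ hs) γ hγ) a
      · simp
      · intro x y _ _ hx hy a
        rw [mul_add, map_add, map_add, hx, hy, add_zero]
      · intro b x _ hx a
        rw [smul_eq_mul, ← mul_assoc]
        exact hx _
    simpa using h2 1
  have hexp : leadExps ord (I.map (MvPowerSeries.map ψ) : Set (MvPowerSeries (Fin n) L)) =
      generatedExps (Set.range α) := by
    refine Set.Subset.antisymm ?_ (hleadL ▸ generatedExps_leadExps_subset hGL)
    rintro ρ ⟨x, hx, hρ⟩
    set u := (recombineEquiv hsel fun g => (hmon g).map ψ).symm x with hu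
    have hux := recombine_symm_apply hsel (fun g => (hmon g).map ψ) x
    rw [← hu] at hux
    have hu0 : u ≠ 0 := by
      intro h0
      rw [h0, map_zero] at hux
      exact hρ.ne_zero hux.symm
    obtain ⟨β, hβ⟩ := ord.exists_isLeadExp hu0
    -- By triangularity `x` and `u` agree at and above the leading exponent of `u`, hence share that
    -- exponent. It must be selected, as `u` vanishes at unselected exponents.
    have hcoeff : ∀ γ, ord.le β γ → coeff γ x = coeff γ u := by
      intro γ hγ
      rw [← hux]
      refine coeff_recombine_of_forall hsel (fun g => (hmon g).map ψ) fun δ hδ => ?_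
      by_contra h
      exact hδ (ord.le_trans _ _ _ (hβ.2 δ h) hγ)
    have hβx : IsLeadExp ord x β := by
      refine ⟨?_, fun γ hγ => ?_⟩
      · simpa [newtonDiagram, hcoeff β (ord.le_refl β)] using hβ.1
      · rcases ord.le_total γ β with h | h
        · exact h
        · refine hβ.2 γ ?_
          simpa [newtonDiagram, hcoeff γ h] using hγ
    rw [hρ.eq hβx]
    rcases h : sel β with _ | g
    · exact absurd (hremL x hx β h) hβ.1
    · obtain ⟨γ, hγ⟩ := exists_add_of_le (hsel.le_of_eq_some _ _ h)
      exact ⟨_, ⟨g, rfl⟩, γ, hγ⟩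
  have hexpK : leadExps ord (I.map (MvPowerSeries.map φ) : Set (MvPowerSeries (Fin n) K)) =
      generatedExps (Set.range α) := by
    rw [hK.isStandardBasis.leadExps_eq, hleadK]
  refine ⟨⟨hG.image _, hGL, ?_, by rw [hexp, hleadL]⟩, ?_, ?_, ?_⟩
  · rintro _ ⟨g, hg, rfl⟩
    exact (hαL ⟨g, hg⟩).ne_zero
  · intro F hF
    rw [hleadL, ← hleadK]
    exact hK.minimal F (by rw [hexpK, ← hexp, hF])
  · rintro _ ⟨g, hg, rfl⟩ β hβ
    rw [hβ.eq (hαL ⟨g, hg⟩)]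
    exact ((hmon ⟨g, hg⟩).map ψ).coeff_eq_one
  · rintro _ ⟨g, hg, rfl⟩ β hβ
    rw [hexp, ← hexpK, hβ.eq (hαL ⟨g, hg⟩)]
    refine Set.Subset.trans ?_ (hK.reduced _ ⟨g, hg, rfl⟩ _ (hα ⟨g, hg⟩))
    refine Set.sdiff_subset_sdiff_left fun γ hγ => ?_
    simp only [newtonDiagram, Set.mem_ofPred_eq, coeff_map, ne_eq] at hγ ⊢
    rw [map_eq_zero_iff φ hφ]
    exact fun h => hγ (by rw [h, map_zero])

/-- A reduced standard basis stays one under further specialization. -/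
theorem IsReducedStandardBasis.map_of_ker_le {φ : R →+* K} {ψ : R →+* L}
    (h : RingHom.ker φ ≤ RingHom.ker ψ)
    {I : Ideal (MvPowerSeries (Fin n) R)} {G : Set (MvPowerSeries (Fin n) R)}
    (hG : G.Finite) (hGI : ∀ g ∈ G, g ∈ I)
    (hK : IsReducedStandardBasis ord (I.map (MvPowerSeries.map φ)) (MvPowerSeries.map φ '' G)) :
    IsReducedStandardBasis ord (I.map (MvPowerSeries.map ψ)) (MvPowerSeries.map ψ '' G) := by
  have hφ : φ = φ.kerLift.comp (Ideal.Quotient.mk _) := by ext; simp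
  let ψ' : R ⧸ RingHom.ker φ →+* L := Ideal.Quotient.lift _ ψ fun a ha => h ha
  have hψ : ψ = ψ'.comp (Ideal.Quotient.mk _) := by ext; rfl
  have key := IsReducedStandardBasis.map_of_injective (ord := ord) φ.kerLift_injective ψ'
    (I := I.map (MvPowerSeries.map (Ideal.Quotient.mk _)))
    (G := MvPowerSeries.map (Ideal.Quotient.mk _) '' G) (hG.image _)
    (by rintro _ ⟨g, hg, rfl⟩; exact Ideal.mem_map_of_mem _ (hGI g hg))
  rw [Ideal.map_map, Ideal.map_map, ← MvPowerSeries.map_comp, ← MvPowerSeries.map_comp, ← hφ, ← hψ,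
    ← Set.image_comp, ← Set.image_comp, ← RingHom.coe_comp, ← RingHom.coe_comp,
    ← MvPowerSeries.map_comp, ← MvPowerSeries.map_comp, ← hφ, ← hψ] at key
  exact key hK

end BaseChange

end GenSB

namespace GenSB

open MvPowerSeries

variable {n : ℕ}

section Exponents

/-- Dickson's lemma: an antichain of exponents is finite. -/
theorem finite_setOf_minimal (D : Set (Fin n →₀ ℕ)) : {e | Minimal (· ∈ D) e}.Finite :=
  WellQuasiOrderedLE.finite_of_isAntichain (setOfPred_minimal_antichain _)

theorem generatedExps_minimal {D : Set (Fin n →₀ ℕ)} (hD : ∀ e ∈ D, ∀ γ, e + γ ∈ D) :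
    generatedExps {e | Minimal (· ∈ D) e} = D := by
  ext β
  constructor
  · rintro ⟨e, he, γ, rfl⟩
    exact hD e he.1 γ
  · intro hβ
    obtain ⟨e, he, hmin⟩ := exists_minimal_le_of_wellFoundedLT (· ∈ D) β hβ
    obtain ⟨γ, hγ⟩ := exists_add_of_le he
    exact ⟨e, hmin, γ, hγ⟩

end Exponents

/-! ### Clearing denominators in finitely many coefficients -/

section Truncation

variable {A K : Type*} [CommRing A] [IsDomain A] [Field K] [Algebra A K] [IsFractionRing A K]

/-- Finitely many coefficients of a member of an ideal of `A[[x]]` extended to `K[[x]]` are, up to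
a common denominator, coefficients of a member of the ideal itself. -/
theorem exists_mem_coeff_eq_mul {J : Ideal (MvPowerSeries (Fin n) A)}
    {f : MvPowerSeries (Fin n) K} (hf : f ∈ J.map (MvPowerSeries.map (algebraMap A K)))
    (S : Finset (Fin n →₀ ℕ)) :
    ∃ c : A, c ≠ 0 ∧ ∃ j ∈ J, ∀ β ∈ S,
      algebraMap A K (coeff β j) = algebraMap A K c * coeff β f := by
  classical
  -- The finite set is quantified inside the induction, since multiplying by `a` requires control of
  -- `x` on the larger set `T`. Only the coefficients of `a` on `T` then need a common denominator.
  refine Submodule.span_induction (p := fun f _ => ∀ S : Finset (Fin n →₀ ℕ),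
    ∃ c : A, c ≠ 0 ∧ ∃ j ∈ J, ∀ β ∈ S,
      algebraMap A K (coeff β j) = algebraMap A K c * coeff β f) ?_ ?_ ?_ ?_ hf S
  · rintro _ ⟨j, hj, rfl⟩ S
    exact ⟨1, one_ne_zero, j, hj, fun β _ => by simp⟩
  · exact fun S => ⟨1, one_ne_zero, 0, J.zero_mem, fun β _ => by simp⟩
  · intro x y _ _ hx hy S
    obtain ⟨c, hc, j, hj, h⟩ := hx S
    obtain ⟨c', hc', j', hj', h'⟩ := hy S
    refine ⟨c * c', mul_ne_zero hc hc', MvPowerSeries.C c' * j + MvPowerSeries.C c * j',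
      J.add_mem (J.mul_mem_left _ hj) (J.mul_mem_left _ hj'), fun β hβ => ?_⟩
    simp only [map_add, coeff_C_mul, map_mul, h β hβ, h' β hβ]
    ring
  · intro a x _ hx S
    let T : Finset (Fin n →₀ ℕ) := S.biUnion Finset.Iic
    obtain ⟨c, hc, j, hj, h⟩ := hx T
    obtain ⟨b, hb⟩ := IsLocalization.exist_integer_multiples (nonZeroDivisors A) T
      fun δ => coeff δ a
    choose r hr using hb
    let a' : MvPowerSeries (Fin n) A := fun δ => if hδ : δ ∈ T then r δ hδ else 0
    refine ⟨b * c, mul_ne_zero (nonZeroDivisors.coe_ne_zero b) hc, a' * j,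
      J.mul_mem_left _ hj, fun β hβ => ?_⟩
    rw [smul_eq_mul, coeff_mul, coeff_mul, map_sum, Finset.mul_sum]
    refine Finset.sum_congr rfl fun p hp => ?_
    rw [Finset.HasAntidiagonal.mem_antidiagonal] at hp
    have h1 : p.1 ∈ T := Finset.mem_biUnion.mpr ⟨β, hβ, by simp [← hp]⟩
    have h2 : p.2 ∈ T := Finset.mem_biUnion.mpr ⟨β, hβ, by simp [← hp]⟩
    have h3 : coeff p.1 a' = r p.1 h1 := dif_pos h1
    rw [h3, map_mul, map_mul, hr, h _ h2, Algebra.smul_def]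
    ring

end Truncation

/-! ### Leading exponents of an ideal and of its extension -/

section LeadExpMod

variable {ord : LocalOrder n}

theorem isLeadExpMod_iff {R K : Type*} [CommRing R] [Field K] {φ : R →+* K} {I : Ideal R}
    (h : ∀ x, x ∈ I ↔ φ x = 0) (f : MvPowerSeries (Fin n) R) (α : Fin n →₀ ℕ) :
    IsLeadExpMod ord I f α ↔ IsLeadExp ord (MvPowerSeries.map φ f) α := by
  simp [IsLeadExpMod, IsLeadExp, newtonDiagram, h]

theorem leadExpsMod_eq {R K : Type*} [CommRing R] [Field K] {φ : R →+* K} {I : Ideal R}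
    (h : ∀ x, x ∈ I ↔ φ x = 0) (S : Set (MvPowerSeries (Fin n) R)) :
    leadExpsMod ord I S = leadExps ord (MvPowerSeries.map φ '' S) := by
  ext α
  simp [leadExpsMod, leadExps, isLeadExpMod_iff h]

/-- Members of `J` whose coefficients at finitely many exponents `≻ α` vanish can be replaced by
members of `J` all of whose exponents are `≼ α`, with the same coefficient at `α`. -/
def HasFiniteLeadTest {A : Type*} [CommRing A] (ord : LocalOrder n)
    (J : Ideal (MvPowerSeries (Fin n) A)) : Prop :=
  ∀ α, ∃ S : Finset (Fin n →₀ ℕ), ∀ j ∈ J, (∀ β ∈ S, ¬ ord.le β α → coeff β j = 0) →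
    ∃ u ∈ J, coeff α u = coeff α j ∧ ∀ β, coeff β u ≠ 0 → ord.le β α

theorem LocalOrder.FiniteAbove.hasFiniteLeadTest {A : Type*} [CommRing A]
    (h : ord.FiniteAbove) (J : Ideal (MvPowerSeries (Fin n) A)) : HasFiniteLeadTest ord J := by
  intro α
  refine ⟨(h α).toFinset, fun j hj h0 => ⟨j, hj, rfl, fun β hβ => ?_⟩⟩
  by_contra h1
  exact hβ (h0 β (by simpa using (ord.le_total α β).resolve_right h1) h1)

/-- A member of `J` approximating a multiple of `f` on a finite set may have uncontrolled exponents
above `α` elsewhere; the finite test removes them without changing the coefficient at `α`. -/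
theorem HasFiniteLeadTest.leadExps_subset {A K : Type*} [CommRing A] [IsDomain A] [Field K]
    [Algebra A K] [IsFractionRing A K] {J : Ideal (MvPowerSeries (Fin n) A)}
    (h : HasFiniteLeadTest ord J) :
    leadExps ord (J.map (MvPowerSeries.map (algebraMap A K)) : Set (MvPowerSeries (Fin n) K)) ⊆
      leadExps ord (MvPowerSeries.map (algebraMap A K) '' (J : Set (MvPowerSeries (Fin n) A))) := by
  classical
  rintro α ⟨f, hf, hα⟩
  have hinj := IsFractionRing.injective A K
  obtain ⟨S, hS⟩ := h α
  obtain ⟨c, hc, j, hj, hjf⟩ := exists_mem_coeff_eq_mul hf (insert α S)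
  obtain ⟨u, hu, huα, hle⟩ := hS j hj fun β hβ hβα => by
    have h1 : coeff β f = 0 := by
      by_contra h2
      exact hβα (hα.2 β h2)
    rw [← map_eq_zero_iff _ hinj, hjf β (Finset.mem_insert_of_mem hβ), h1, mul_zero]
  refine ⟨_, ⟨u, hu, rfl⟩, ?_, fun β hβ => hle β fun h0 => hβ (by simp [h0])⟩
  change coeff α _ ≠ 0
  rw [coeff_map, huα, hjf α (Finset.mem_insert_self _ _)]
  exact mul_ne_zero ((map_ne_zero_iff _ hinj).mpr hc) hα.1

end LeadExpMod

/-! ### The Noetherian case by Artin–Rees -/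

section Noetherian

variable {A : Type*} [CommRing A]

/-- The ideal generated by the variables. -/
def varIdeal (n : ℕ) (A : Type*) [CommRing A] : Ideal (MvPowerSeries (Fin n) A) :=
  Ideal.span (Set.range X)

theorem natCast_le_order_of_mem_varIdeal_pow {N : ℕ} {f : MvPowerSeries (Fin n) A}
    (hf : f ∈ varIdeal n A ^ N) : (N : ℕ∞) ≤ f.order := by
  induction N generalizing f with
  | zero => simp
  | succ N ih =>
    rw [pow_succ] at hf
    refine Submodule.mul_induction_on hf ?_ ?_
    · intro a ha b hb
      have hb' : constantCoeff b = 0 := by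
        have : varIdeal n A ≤ RingHom.ker (constantCoeff (σ := Fin n) (R := A)) :=
          Ideal.span_le.mpr (by rintro _ ⟨i, rfl⟩; simp)
        exact this hb
      rw [Nat.cast_add, Nat.cast_one]
      exact (add_le_add (ih ha) (one_le_order_iff_constCoeff_eq_zero.mpr hb')).trans le_order_mul
    · exact fun a b ha hb => (le_min ha hb).trans min_order_le_add

theorem mem_varIdeal_pow_of_le_order {N : ℕ} {f : MvPowerSeries (Fin n) A}
    (hf : (N : ℕ∞) ≤ f.order) : f ∈ varIdeal n A ^ N := by
  classical
  induction N generalizing f with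
  | zero => simp
  | succ N ih =>
    obtain ⟨sel, hsel⟩ := exists_isSelector fun i : Fin n => Finsupp.single i 1
    -- Division by the variables has no tails, so recombining is the identity. The only unselected
    -- exponent is `0`, where the coefficient vanishes because the order is positive.
    have h1 : recombine sel (fun i => Finsupp.single i 1) X f = f := by
      ext γ
      rw [coeff_recombine hsel]
      simp [coeff_X]
    have h2 : unselectedPart sel f = 0 := by
      ext γ
      rw [coeff_unselectedPart, map_zero]
      split_ifs with h
      · refine coeff_of_lt_order (lt_of_lt_of_le ?_ hf)
        have : γ = 0 := by
          ext i
          have := hsel.not_le_of_eq_none _ h i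
          rw [Finsupp.single_le_iff] at this
          simpa using this
        simp [this]
      · rfl
    rw [← h1, recombine_apply, h2, add_zero]
    refine Ideal.sum_mem _ fun i _ => ?_
    rw [pow_succ]
    refine Ideal.mul_mem_mul (ih (le_order fun d hd => ?_)) (Ideal.subset_span ⟨i, rfl⟩)
    rw [coeff_selectedPart]
    split_ifs
    · refine coeff_of_lt_order (lt_of_lt_of_le ?_ hf)
      rw [map_add, Finsupp.degree_single]
      exact_mod_cast Nat.add_lt_add_right (by exact_mod_cast hd) 1
    · rfl

/-- The ideal of the series all of whose exponents are `≼ α`. -/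
def leIdeal (ord : LocalOrder n) (A : Type*) [CommRing A] (α : Fin n →₀ ℕ) :
    Ideal (MvPowerSeries (Fin n) A) where
  carrier := {f | ∀ β, coeff β f ≠ 0 → ord.le β α}
  zero_mem' β h := absurd (map_zero _) h
  add_mem' {a b} ha hb β h := by
    by_cases h1 : coeff β a = 0
    · exact hb β fun h2 => h (by rw [map_add, h1, h2, add_zero])
    · exact ha β h1
  smul_mem' c x hx β h := by
    classical
    rw [smul_eq_mul, coeff_mul] at h
    obtain ⟨p, hp, h1⟩ := Finset.exists_ne_zero_of_sum_ne_zero h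
    refine ord.le_trans _ _ _ (ord.le_of_ge ?_) (hx p.2 (right_ne_zero_of_mul h1))
    rw [← Finset.HasAntidiagonal.mem_antidiagonal.mp hp]
    exact le_add_self

/-- Artin–Rees is applied to the image of `J` in the quotient by `leIdeal ord A α`, where only
exponents above `α` matter. If `j` is highly divisible there, it agrees there with some `v` in a
high power of the variable ideal times `J`, and `j - v` is the required series. -/
theorem hasFiniteLeadTest_of_isNoetherianRing [IsNoetherianRing A] (ord : LocalOrder n)
    (J : Ideal (MvPowerSeries (Fin n) A)) : HasFiniteLeadTest ord J := by
  classical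
  intro α
  let F := leIdeal ord A α
  let q : MvPowerSeries (Fin n) A →ₗ[MvPowerSeries (Fin n) A] MvPowerSeries (Fin n) A ⧸ F :=
    Submodule.mkQ F
  obtain ⟨k, hk⟩ := (varIdeal n A).exists_pow_inf_eq_pow_smul (Submodule.map q J)
  -- With `k` the Artin–Rees constant, `N - k` exceeds the degree of `α`, so `v` below has no term
  -- at `α`.
  let N := k + (α.degree + 1)
  -- The box with all sides `N` contains every exponent of degree less than `N`.
  refine ⟨Finset.Iic (Finsupp.equivFunOnFinite.symm fun _ => N), fun j hj h0 => ?_⟩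
  let w : MvPowerSeries (Fin n) A := fun β => if ord.le β α then 0 else coeff β j
  have hw : ∀ β, coeff β w = if ord.le β α then 0 else coeff β j := fun β => rfl
  have hwN : w ∈ varIdeal n A ^ N := by
    refine mem_varIdeal_pow_of_le_order (le_order fun d hd => ?_)
    rw [hw]
    split_ifs with h
    · rfl
    · refine h0 d (Finset.mem_Iic.mpr fun i => ?_) h
      have hd' : d.degree < N := by exact_mod_cast hd
      exact (Finsupp.le_degree i d).trans hd'.le
  have hqw : q j = q w := by
    refine (Submodule.Quotient.eq F).mpr fun β hβ => ?_
    by_contra h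
    exact hβ (by rw [map_sub, hw, if_neg h, sub_self])
  have hmem : q j ∈ varIdeal n A ^ N • (⊤ : Submodule (MvPowerSeries (Fin n) A) _) ⊓
      Submodule.map q J := by
    refine ⟨?_, ⟨j, hj, rfl⟩⟩
    rw [hqw, ← mul_one w, ← smul_eq_mul, map_smul]
    exact Submodule.smul_mem_smul hwN trivial
  rw [hk N (Nat.le_add_right _ _)] at hmem
  have hmem2 : q j ∈ Submodule.map q (varIdeal n A ^ (N - k) • J) := by
    rw [Submodule.map_smul'']
    exact Submodule.smul_mono le_rfl inf_le_right hmem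
  obtain ⟨v, hv, hvj⟩ := hmem2
  have hv' : v ∈ varIdeal n A ^ (N - k) * J := hv
  have hvα : coeff α v = 0 := by
    refine coeff_of_lt_order (lt_of_lt_of_le ?_
      (natCast_le_order_of_mem_varIdeal_pow (Ideal.mul_le_left hv')))
    exact_mod_cast (by omega : α.degree < N - k)
  refine ⟨j - v, J.sub_mem hj (Ideal.mul_le_right hv'), by rw [map_sub, hvα, sub_zero], ?_⟩
  exact (Submodule.Quotient.eq F).mp hvj.symm

end Noetherian

theorem map_surjective_of_surjective {R S : Type*} [CommRing R] [CommRing S] {φ : R →+* S}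
    (hφ : Function.Surjective φ) : Function.Surjective (MvPowerSeries.map (σ := Fin n) φ) := by
  intro x
  choose y hy using fun β => hφ (coeff β x)
  exact ⟨fun β => y β, by ext β; exact hy β⟩

/-! ### Construction of the reduced standard basis -/

section Existence

variable {ord : LocalOrder n} {B K : Type*} [CommRing B] [Field K]

/-- If monic members of `I` realize the minimal leading exponents of the extension of `I` to
`K[[x]]`, then the reduced standard basis of this extension comes from `I`. -/
theorem exists_isReducedStandardBasis {φ : B →+* K} {I : Ideal (MvPowerSeries (Fin n) B)}
    {E : Set (Fin n →₀ ℕ)} (hE : E.Finite) (hanti : ∀ e ∈ E, ∀ d ∈ E, d ≤ e → d = e)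
    (hIE : leadExps ord (I.map (MvPowerSeries.map φ) : Set (MvPowerSeries (Fin n) K)) =
      generatedExps E)
    (hf : ∀ e ∈ E, ∃ f ∈ I, coeff e f = 1 ∧ IsLeadExp ord (MvPowerSeries.map φ f) e) :
    ∃ G : Set (MvPowerSeries (Fin n) B), G.Finite ∧ (∀ g ∈ G, g ∈ I) ∧
      (∀ g ∈ G, ∃ e, coeff e g = 1 ∧ IsLeadExp ord (MvPowerSeries.map φ g) e) ∧
      IsReducedStandardBasis ord (I.map (MvPowerSeries.map φ)) (MvPowerSeries.map φ '' G) := by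
  classical
  have : Fintype E := hE.fintype
  choose f hfI hf1 hflead using fun e : E => hf e.1 e.2
  -- Over `B` the series `f e` may have exponents above `e` with coefficients in the kernel of `φ`;
  -- it becomes monic only modulo that kernel.
  let π := Ideal.Quotient.mk (RingHom.ker φ)
  have hπ : ∀ g : MvPowerSeries (Fin n) B,
      MvPowerSeries.map φ g = MvPowerSeries.map φ.kerLift (MvPowerSeries.map π g) := by
    intro g
    ext β
    simp [π]
  have hmon : ∀ e : E, IsMonicAt ord (MvPowerSeries.map π (f e)) e.1 := by
    refine fun e => ⟨by simp [hf1], fun β hβ => (hflead e).2 β fun h0 => hβ ?_⟩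
    rw [coeff_map] at h0 ⊢
    exact Ideal.Quotient.eq_zero_iff_mem.mpr h0
  obtain ⟨sel, hsel⟩ := exists_isSelector fun e : E => e.1
  have hsel_none : ∀ β, sel β = none →
      β ∉ leadExps ord (I.map (MvPowerSeries.map φ) : Set (MvPowerSeries (Fin n) K)) := by
    intro β hβ h
    rw [hIE] at h
    obtain ⟨e, he, γ, rfl⟩ := h
    exact hsel.not_le_of_eq_none _ hβ ⟨e, he⟩ le_self_add
  have key : ∀ e : E, ∃ g ∈ I, coeff e.1 g = 1 ∧
      ∀ β ≠ e.1, coeff β (MvPowerSeries.map φ g) ≠ 0 →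
        β ∉ leadExps ord (I.map (MvPowerSeries.map φ) : Set (MvPowerSeries (Fin n) K)) := by
    intro e
    have hse : sel e.1 ≠ none := fun h => hsel.not_le_of_eq_none _ h e le_rfl
    -- Subtracting from `x ^ e` its remainder gives the reduced element with leading exponent `e`.
    set u := (recombineEquiv hsel hmon).symm (monomial e.1 1) with hu
    have h1 : monomial e.1 1 - unselectedPart sel u ∈ I.map (MvPowerSeries.map π) := by
      have h2 := recombine_symm_apply hsel hmon (monomial e.1 1)
      rw [← hu, recombine_apply] at h2
      rw [← h2, add_sub_cancel_right]
      exact Ideal.sum_mem _ fun i _ => Ideal.mul_mem_left _ _ (Ideal.mem_map_of_mem _ (hfI i))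
    obtain ⟨g, hg, hgu⟩ := (Ideal.mem_map_iff_of_surjective _
      (map_surjective_of_surjective Ideal.Quotient.mk_surjective)).mp h1
    have h3 : π (coeff e.1 g) = 1 := by
      rw [← coeff_map, hgu, map_sub, coeff_monomial_same, coeff_unselectedPart_eq_zero sel _ hse,
        sub_zero]
    have h5 : π (coeff e.1 g - 1) = 0 := by rw [map_sub, h3, map_one, sub_self]
    -- The lift has coefficient `1` at `e` only modulo the kernel. The correction makes it exactly
    -- `1` over `B` without changing the image under `φ`.
    refine ⟨g - MvPowerSeries.C (coeff e.1 g - 1) * f e, I.sub_mem hg (I.mul_mem_left _ (hfI e)),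
      by rw [map_sub, coeff_C_mul, hf1]; ring, fun β hβ h0 => ?_⟩
    apply hsel_none
    by_contra h4
    apply h0
    rw [hπ, map_sub, map_mul, hgu, map_C, h5, map_zero, zero_mul,
      sub_zero, coeff_map, map_sub, coeff_monomial_ne hβ, coeff_unselectedPart_eq_zero sel _ h4,
      sub_zero, map_zero]
  choose g hgI hg1 hgred using key
  have hgmem : ∀ e, MvPowerSeries.map φ (g e) ∈ I.map (MvPowerSeries.map φ) := fun e =>
    Ideal.mem_map_of_mem _ (hgI e)
  have hg1' : ∀ e : E, coeff e.1 (MvPowerSeries.map φ (g e)) = 1 := fun e => by simp [hg1]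
  have hlead : ∀ e : E, IsLeadExp ord (MvPowerSeries.map φ (g e)) e.1 := by
    intro e
    have h0 : MvPowerSeries.map φ (g e) ≠ 0 := fun h => by simpa [h] using hg1' e
    obtain ⟨ρ, hρ⟩ := ord.exists_isLeadExp h0
    -- The leading exponent belongs to the set of leading exponents of the ideal, and `e` is the
    -- only exponent of the series that can lie there.
    by_cases h : ρ = e.1
    · exact h ▸ hρ
    · exact absurd ⟨_, hgmem e, hρ⟩ (hgred e ρ h hρ.1)
  have hleadG : leadExps ord (MvPowerSeries.map φ '' Set.range g) = E := by
    ext β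
    constructor
    · rintro ⟨_, ⟨_, ⟨e, rfl⟩, rfl⟩, h⟩
      rw [h.eq (hlead e)]
      exact e.2
    · intro hβ
      exact ⟨_, ⟨_, ⟨⟨β, hβ⟩, rfl⟩, rfl⟩, hlead ⟨β, hβ⟩⟩
  refine ⟨Set.range g, Set.finite_range g, ?_, ?_, ⟨⟨(Set.finite_range g).image _, ?_, ?_, ?_⟩,
    ?_, ?_, ?_⟩⟩
  · rintro _ ⟨e, rfl⟩
    exact hgI e
  · rintro _ ⟨e, rfl⟩
    exact ⟨e.1, hg1 e, hlead e⟩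
  · rintro _ ⟨_, ⟨e, rfl⟩, rfl⟩
    exact hgmem e
  · rintro _ ⟨_, ⟨e, rfl⟩, rfl⟩
    exact (hlead e).ne_zero
  · rw [hleadG, hIE]
  · intro F hF
    rw [hleadG]
    intro e he
    rw [hIE] at hF
    have h1 : e ∈ generatedExps F := hF ▸ ⟨e, he, 0, (add_zero e).symm⟩
    obtain ⟨d, hd, γ, rfl⟩ := h1
    have h2 : d ∈ generatedExps E := hF ▸ ⟨d, hd, 0, (add_zero d).symm⟩
    obtain ⟨e', he', γ', rfl⟩ := h2
    -- The generator `e'` divides `d`, which divides `e`; since `E` is an antichain all three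
    -- coincide.
    have h3 := hanti _ he _ he' (by rw [add_assoc]; exact le_self_add)
    rw [add_assoc, left_eq_add, add_eq_zero] at h3
    rw [h3.2, add_zero]
    exact hd
  · rintro _ ⟨_, ⟨e, rfl⟩, rfl⟩ β hβ
    rw [hβ.eq (hlead e)]
    exact hg1' e
  · rintro _ ⟨_, ⟨e, rfl⟩, rfl⟩ β hβ γ ⟨hγ, hne⟩
    rw [hβ.eq (hlead e)] at hne
    exact hgred e γ hne hγ

end Existence

end GenSB

namespace GenSB

open MvPowerSeries

variable {n : ℕ} {C : Type*} [CommRing C]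

/-! ### Specialization and the two parts of the theorem -/

theorem mem_ideal_iff_specialize (P : Ideal C) [P.IsPrime] (c : C) :
    c ∈ P ↔ specialize P c = 0 := by
  change _ ↔ algebraMap (C ⧸ P) (FractionRing (C ⧸ P)) (Ideal.Quotient.mk P c) = 0
  rw [FaithfulSMul.algebraMap_eq_zero_iff, Ideal.Quotient.eq_zero_iff_mem]

theorem specializeAway_comp (P : Ideal C) [P.IsPrime] {h : C} (hP : h ∉ P) :
    (specializeAway P hP).comp (algebraMap C (Localization.Away h)) = specialize P :=
  IsLocalization.Away.lift_comp h (isUnit_specialize P hP)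

theorem specializeAway_algebraMap (P : Ideal C) [P.IsPrime] {h : C} (hP : h ∉ P) (c : C) :
    specializeAway P hP (algebraMap C (Localization.Away h) c) = specialize P c :=
  IsLocalization.Away.lift_eq h (isUnit_specialize P hP) c

theorem mem_awayIdeal_iff (P : Ideal C) [P.IsPrime] {h : C} (hP : h ∉ P)
    (x : Localization.Away h) : x ∈ awayIdeal P h ↔ specializeAway P hP x = 0 := by
  constructor
  · intro hx
    have : awayIdeal P h ≤ RingHom.ker (specializeAway P hP) := by
      refine Ideal.map_le_iff_le_comap.mpr fun c hc => ?_
      rw [Ideal.mem_comap, RingHom.mem_ker, specializeAway_algebraMap]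
      exact (mem_ideal_iff_specialize P c).mp hc
    exact this hx
  · intro hx
    obtain ⟨⟨a, s⟩, hs⟩ := IsLocalization.surj (Submonoid.powers h) x
    have ha : a ∈ P := by
      rw [mem_ideal_iff_specialize, ← specializeAway_algebraMap P hP]
      simp only at hs
      rw [← hs, map_mul, hx, zero_mul]
    have h1 : x * algebraMap C (Localization.Away h) s ∈ awayIdeal P h := by
      rw [hs]
      exact Ideal.mem_map_of_mem _ ha
    rwa [Ideal.mul_unit_mem_iff_mem _ (IsLocalization.map_units _ s)] at h1

theorem ker_specializeAway_le {P Q : Ideal C} [P.IsPrime] [Q.IsPrime] (hQP : Q ≤ P) {h : C}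
    (hQ : h ∉ Q) (hP : h ∉ P) :
    RingHom.ker (specializeAway Q hQ) ≤ RingHom.ker (specializeAway P hP) := by
  intro x hx
  rw [RingHom.mem_ker, ← mem_awayIdeal_iff] at hx ⊢
  exact Ideal.map_mono hQP hx

theorem specializeIdeal_eq_map (P : Ideal C) [P.IsPrime] {h : C} (hP : h ∉ P)
    (J : Ideal (MvPowerSeries (Fin n) C)) :
    specializeIdeal P J = (extendAway J h).map (MvPowerSeries.map (specializeAway P hP)) := by
  rw [extendAway, Ideal.map_map, ← MvPowerSeries.map_comp, specializeAway_comp]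
  rfl

theorem specializeIdeal_eq_map_map (P : Ideal C) (J : Ideal (MvPowerSeries (Fin n) C)) :
    specializeIdeal P J = (J.map (MvPowerSeries.map (Ideal.Quotient.mk P))).map
      (MvPowerSeries.map (algebraMap (C ⧸ P) (FractionRing (C ⧸ P)))) := by
  rw [Ideal.map_map, ← MvPowerSeries.map_comp]
  rfl

/-- Passing to the fraction field creates no new leading exponents. The alternative in the
hypothesis serves to supply the finite lead test over `C ⧸ Q`. -/
theorem leadExps_specializeIdeal {ord : LocalOrder n} {Q : Ideal C} [Q.IsPrime]
    (h : IsNoetherianRing (C ⧸ Q) ∨ ord.FiniteAbove) (J : Ideal (MvPowerSeries (Fin n) C)) :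
    leadExps ord (specializeIdeal Q J : Set (MvPowerSeries (Fin n) (FractionRing (C ⧸ Q)))) =
      leadExpsMod ord Q (J : Set (MvPowerSeries (Fin n) C)) := by
  rw [leadExpsMod_eq (mem_ideal_iff_specialize Q)]
  refine Set.Subset.antisymm ?_ ?_
  · have htest : HasFiniteLeadTest ord (J.map (MvPowerSeries.map (Ideal.Quotient.mk Q))) := by
      rcases h with h | h
      · exact hasFiniteLeadTest_of_isNoetherianRing ord _
      · exact h.hasFiniteLeadTest _
    rw [specializeIdeal_eq_map_map]
    refine htest.leadExps_subset.trans ?_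
    rintro α ⟨_, ⟨u, hu, rfl⟩, hα⟩
    obtain ⟨f, hf, rfl⟩ := (Ideal.mem_map_iff_of_surjective _
      (map_surjective_of_surjective Ideal.Quotient.mk_surjective)).mp hu
    exact ⟨_, ⟨f, hf, rfl⟩, hα⟩
  · rintro α ⟨_, ⟨f, hf, rfl⟩, hα⟩
    exact ⟨_, Ideal.subset_span ⟨f, hf, rfl⟩, hα⟩

theorem exists_isGenericReducedStandardBasis {ord : LocalOrder n} {Q : Ideal C} [Q.IsPrime]
    (hQ : IsNoetherianRing (C ⧸ Q) ∨ ord.FiniteAbove) (J : Ideal (MvPowerSeries (Fin n) C)) :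
    ∃ (h : C) (G : Set (MvPowerSeries (Fin n) (Localization.Away h))),
      IsGenericReducedStandardBasis ord J Q h G := by
  classical
  set D := leadExps ord
    (specializeIdeal Q J : Set (MvPowerSeries (Fin n) (FractionRing (C ⧸ Q)))) with hD
  have hDadd : ∀ e ∈ D, ∀ γ, e + γ ∈ D := by
    rintro e ⟨f, hf, he⟩ γ
    exact ⟨_, Ideal.mul_mem_right _ _ hf, he.mul_monomial γ⟩
  let E := {e | Minimal (· ∈ D) e}
  have hE : E.Finite := finite_setOf_minimal D
  have hED : generatedExps E = D := generatedExps_minimal hDadd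
  have : Fintype E := hE.fintype
  have hf : ∀ e : E, ∃ f ∈ J, IsLeadExpMod ord Q f e.1 := fun e => by
    have h1 : e.1 ∈ D := e.2.1
    rwa [hD, leadExps_specializeIdeal hQ J] at h1
  choose f hfJ hf using hf
  -- Inverting `h` inverts the leading coefficients modulo `Q` at all minimal exponents
  -- simultaneously.
  let h : C := ∏ e, coeff e.1 (f e)
  have hh : h ∉ Q := fun hmem => by
    obtain ⟨e, _, he⟩ := (Ideal.IsPrime.prod_mem_iff (p := Q)).mp hmem
    exact (hf e).1 he
  have hunit : ∀ e : E, IsUnit (algebraMap C (Localization.Away h) (coeff e.1 (f e))) :=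
    fun e => isUnit_of_dvd_unit (map_dvd _ (Finset.dvd_prod_of_mem (fun e : E => coeff e.1 (f e)) (Finset.mem_univ e)))
      (IsLocalization.Away.algebraMap_isUnit h)
  obtain ⟨G, hG, hGI, hGlead, hGred⟩ := exists_isReducedStandardBasis (ord := ord)
    (φ := specializeAway Q hh) (I := extendAway J h) hE
    (fun e he d hd hde => he.eq_of_le hd.1 hde)
    (by rw [← specializeIdeal_eq_map, hED]) (by
      intro e he
      obtain ⟨v, hv⟩ := (hunit ⟨e, he⟩).exists_left_inv
      refine ⟨MvPowerSeries.C v * MvPowerSeries.map (algebraMap C _) (f ⟨e, he⟩),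
        Ideal.mul_mem_left _ _ (Ideal.mem_map_of_mem _ (hfJ _)), ?_, ?_⟩
      · rw [coeff_C_mul, coeff_map, hv]
      · have hv0 : specializeAway Q hh v ≠ 0 := fun h0 => by
          have := congrArg (specializeAway Q hh) hv
          rw [map_mul, h0, zero_mul, map_one] at this
          exact zero_ne_one this
        have h1 := (isLeadExpMod_iff (mem_ideal_iff_specialize Q) _ _).mp (hf ⟨e, he⟩)
        simpa [IsLeadExp, newtonDiagram, coeff_C_mul, specializeAway_algebraMap, hv0] using h1)
  rw [← specializeIdeal_eq_map] at hGred
  refine ⟨h, G, ⟨hh, hG, hGI, fun g hg => ?_, ?_⟩, hGred⟩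
  · obtain ⟨e, he1, he⟩ := hGlead g hg
    -- The leading coefficient is exactly `1` over `C[h⁻¹]`, hence the form `c / h ^ k` with `c = 1`
    -- and `k = 0`.
    exact ⟨e, (isLeadExpMod_iff (mem_awayIdeal_iff Q hh) _ _).mpr he, 1, 0, one_dvd h,
      by simp [he1]⟩
  · rw [← leadExps_specializeIdeal hQ, hGred.isStandardBasis.leadExps_eq,
      leadExpsMod_eq (mem_awayIdeal_iff Q hh)]

end GenSB

end

theorem mainTheorem2 {C : Type*} [CommRing C] [IsDomain C] {n : ℕ} (ord : GenSB.LocalOrder n)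
    (J : Ideal (MvPowerSeries (Fin n) C)) (Q : Ideal C) [Q.IsPrime] :
    ((IsNoetherianRing (C ⧸ Q) ∨ ord.FiniteAbove) →
      ∃ (h : C) (G : Set (MvPowerSeries (Fin n) (Localization.Away h))),
        GenSB.IsGenericReducedStandardBasis ord J Q h G) ∧
    ∀ (h : C) (G : Set (MvPowerSeries (Fin n) (Localization.Away h))),
      GenSB.IsGenericReducedStandardBasis ord J Q h G →
      ∀ (P : Ideal C) [P.IsPrime], Q ≤ P → ∀ hP : h ∉ P,
        GenSB.IsReducedStandardBasis ord (GenSB.specializeIdeal P J)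
          (GenSB.specializeSet P hP G) := by
  refine ⟨fun hQ => GenSB.exists_isGenericReducedStandardBasis hQ J, ?_⟩
  rintro h G ⟨hG, hred⟩ P _ hQP hP
  rw [GenSB.specializeIdeal_eq_map Q hG.notMem] at hred
  rw [GenSB.specializeIdeal_eq_map P hP]
  exact hred.map_of_ker_le (GenSB.ker_specializeAway_le hQP hG.notMem hP) hG.finite hG.subset
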